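/- **Definitions.** A *semigroupoid* is a set $S$ with a subset $S^{(2)}\subseteq S\times S$ and a product $S^{(2)}\to S$, $(f,g)\mapsto fg$, such that whenever $(f,g),(g,h)\in S^{(2)}$, or $(f,g),(fg,h)\in S^{(2)}$, or $(g,h),(f,gh)\in S^{(2)}$, all of $(f,g),(g,h),(fg,h),(f,gh)$ lie in $S^{(2)}$ and $(fg)h=f(gh)$. Write $f\mid g$ if $f=g$ or $g=fh$ for some $h$ with $(f,h)\in S^{(2)}$; $f$ and $g$ *intersect* if they have a common multiple $m$ (that is, $f\mid m$ and $g\mid m$). Let $\tilde S=S\sqcup\{1\}$, $S^f=\{g\in S:(f,g)\in S^{(2)}\}$ for $f\in S$, and $S^1=S$. A subset $H\subseteq X\subseteq S$ is a *covering* of $X$ if each element of $X$ intersects some element of $H$. A *representation* of $S$ in a unital C*-algebra $B$ is a map $f\mapsto T_f$ from $S$ to the partial isometries of $B$ with $T_fT_g=T_{fg}$ if $(f,g)\in S^{(2)}$ and $T_fT_g=0$ otherwise, such that the projections $Q_f=T_f^*T_f$ and $P_f=T_fT_f^*$ ($f\in S$) all commute with one another, $P_fP_g=0$ if $f,g$ do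 not intersect, and $Q_fP_g=P_g$ if $(f,g)\in S^{(2)}$; put $Q_1=1$. It is *tight* if for all finite $F,G\subseteq\tilde S$ and every finite covering $H$ of $\bigcap_{f\in F}S^f\cap\bigcap_{g\in G}(S\setminus S^g)$ one has $\bigvee_{h\in H}P_h=\prod_{f\in F}Q_f\prod_{g\in G}(1-Q_g)$, where $P\vee P'=P+P'-PP'$ for commuting projections. Let $\tilde{\mathcal O}(S)$ be the universal unital C*-algebra generated by a tight representation $\hat s$ of $S$; the *semigroupoid C*-algebra* $\mathcal O(S)$ is the closed *-subalgebra of $\tilde{\mathcal O}(S)$ generated by $\{\hat s_f:f\in S\}$. The morphisms of a small category form a semigroupoid, in which $fg=f\circ g$ is defined if and only if the domain $s(f)$ equals the co-domain $r(g)$. Let $k\ge 0$. A *$k$-graph* is a small category $\Lambda$, identified with its set of morphisms, with objects identified with their identity morphisms, together with a functor $d:\Lambda\to\mathbb N^k$ such that whenever $d(f)=m+n$ there is a unique pair $(g,h)$ with $f=gh$, $d(g)=m$ and $d(h)=n$. For an object $v$ and $n\in\mathbb N^k$ let $\Lambda^v_n=\{f\in\Lambda:r(f)=v,\ d(f)=n\}$.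 If $0<|\Lambda^v_n|<\infty$ for all $v$ and $n$ (the $k$-graph is row-finite and has no sources), the Kumjian–Pask algebra $C^*(\Lambda)=C^*(\Lambda,d)$ is the universal C*-algebra generated by partial isometries $\check s_f$, $f\in\Lambda$, such that (i) the $\check s_v$, for objects $v$, are mutually orthogonal projections; (ii) $\check s_{fg}=\check s_f\check s_g$ if $s(f)=r(g)$; (iii) $\check s_f^*\check s_f=\check s_{s(f)}$ for all $f$; (iv) $\check s_v=\sum_{f\in\Lambda^v_n}\check s_f\check s_f^*$ for all objects $v$ and all $n\in\mathbb N^k$. **Theorem.** Let $(\Lambda,d)$ be a $k$-graph such that $0<|\Lambda^v_n|<\infty$ for all objects $v$ and all $n\in\mathbb N^k$. Then $C^*(\Lambda)$ is *-isomorphic to the semigroupoid C*-algebra $\mathcal O(\Lambda)$ of the underlying category viewed as a semigroupoid, by an isomorphism that sends $\check s_f$ to $\hat s_f$ for every $f\in\Lambda$. Consequently $C^*(\Lambda)$ does not depend on the degree functor: if $d':\Lambda\to\mathbb N^{l}$, for some $l\ge 0$, is another degree functor on the same category that makes it a row-finite $l$-graph without sources, then $C^*(\Lambda,d)\cong C^*(\Lambda,d')$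 by a *-isomorphism that sends canonical generators to canonical generators. -/

import Mathlib

open CategoryTheory
open scoped ENNReal

universe u v w

/-- `a` is a partial isometry: `a a* a = a`. -/
def IsPartialIsometry {B : Type*} [Mul B] [Star B] (a : B) : Prop :=
  a * star a * a = a

theorem IsPartialIsometry.norm_le_one {B : Type*} [NonUnitalCStarAlgebra B] {a : B}
    (ha : IsPartialIsometry a) : ‖a‖ ≤ 1 := by
  have h1 : (star a * a) * (star a * a) = star a * a := by
    have h : a * star a * a = a := ha
    calc (star a * a) * (star a * a) = star a * (a * star a * a) := by simp only [mul_assoc]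
      _ = star a * a := by rw [h]
  have h2 : star (star a * a) = star a * a := by simp
  have h3 : ‖star a * a‖ * ‖star a * a‖ = ‖star a * a‖ := by
    conv_rhs => rw [← h1]
    conv_rhs => rw [← h2]
    rw [h2]
    have := CStarRing.norm_star_mul_self (x := star a * a)
    rw [h2] at this
    exact this.symm
  have h4 : ‖star a * a‖ = ‖a‖ * ‖a‖ := CStarRing.norm_star_mul_self
  rw [h4] at h3
  by_contra! hlt
  nlinarith [mul_pos (zero_lt_one.trans hlt) (zero_lt_one.trans hlt),
    mul_lt_mul'' hlt hlt zero_le_one zero_le_one]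

/-! ### Semigroupoids -/

/-- A semigroupoid: a set `S` with a set of composable pairs and an associative partial product. -/
class Semigroupoid (S : Type u) where
  /-- `Composable f g` says that `(f, g)` belongs to the set `S⁽²⁾` of composable pairs. -/
  Composable : S → S → Prop
  /-- The product `fg` of a composable pair. -/
  mul : ∀ f g : S, Composable f g → S
  assoc : ∀ f g h : S,
    ((Composable f g ∧ Composable g h) ∨
      (∃ hfg : Composable f g, Composable (mul f g hfg) h) ∨
      (∃ hgh : Composable g h, Composable f (mul g h hgh))) →
    ∃ (hfg : Composable f g) (hgh : Composable g h)
      (h₁ : Composable (mul f g hfg) h) (h₂ : Composable f (mul g h hgh)),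
      mul (mul f g hfg) h h₁ = mul f (mul g h hgh) h₂

namespace Semigroupoid

variable {S : Type u} [Semigroupoid S]

/-- `f` divides `g`. -/
def Divides (f g : S) : Prop :=
  f = g ∨ ∃ (h : S) (hc : Composable f h), mul f h hc = g

/-- `f` and `g` intersect: they have a common multiple. -/
def Intersects (f g : S) : Prop := ∃ m : S, Divides f m ∧ Divides g m

/-- The set of all `g` such that `fg` is defined, for `f` in the unitization `S ∪ {1}`, which is
modelled by `Option S` with `none` in the role of `1`; it is all of `S` for `f = 1`. -/
def rightSet : Option S → Set S
  | none => Set.univ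
  | some f => {g | Composable f g}

/-- The elements of `S` that lie in `rightSet f` for all `f ∈ F` and in no `rightSet g`
for `g ∈ G`. -/
def cylinder (F G : Finset (Option S)) : Set S :=
  {h | (∀ f ∈ F, h ∈ rightSet f) ∧ ∀ g ∈ G, h ∉ rightSet g}

/-- `H` is a covering of `X`. -/
def IsCovering (H X : Set S) : Prop :=
  H ⊆ X ∧ ∀ f ∈ X, ∃ h ∈ H, Intersects h f

/-- A representation of a semigroupoid in a unital C*-algebra. -/
structure IsRepresentation {B : Type*} [CStarAlgebra B] (T : S → B) : Prop where
  partialIsometry : ∀ f, IsPartialIsometry (T f)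
  map_mul : ∀ f g (h : Composable f g), T f * T g = T (mul f g h)
  mul_eq_zero : ∀ f g, ¬ Composable f g → T f * T g = 0
  commute_initial_initial : ∀ f g, Commute (star (T f) * T f) (star (T g) * T g)
  commute_initial_final : ∀ f g, Commute (star (T f) * T f) (T g * star (T g))
  commute_final_final : ∀ f g, Commute (T f * star (T f)) (T g * star (T g))
  final_mul_final : ∀ f g, ¬ Intersects f g → (T f * star (T f)) * (T g * star (T g)) = 0
  initial_mul_final : ∀ f g, Composable f g →
    (star (T f) * T f) * (T g * star (T g)) = T g * star (T g)

/-- The initial projection of `T f`, for `f` in the unitization; it is `1` for `f = 1`. -/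
def initialProj {B : Type*} [CStarAlgebra B] (T : S → B) : Option S → B
  | none => 1
  | some f => star (T f) * T f

/-- The join of a finite list of commuting projections, where `p ∨ q = p + q - p q`. -/
def joinList {B : Type*} [Ring B] : List B → B
  | [] => 0
  | p :: l => p + joinList l - p * joinList l

/-- A tight representation. All the projections involved commute, so that the order in which
`Finset.toList` lists the members of a finite set has no influence on the products and joins. -/
structure IsTightRepresentation {B : Type*} [CStarAlgebra B] (T : S → B) : Prop
    extends IsRepresentation T where
  tight : ∀ (F G : Finset (Option S)) (H : Finset S), IsCovering (H : Set S) (cylinder F G) →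
    joinList (H.toList.map fun h => T h * star (T h)) =
      (F.toList.map fun f => initialProj T f).prod *
        (G.toList.map fun g => 1 - initialProj T g).prod

end Semigroupoid

/-! ### Universal C*-algebras

The universal C*-algebra generated by partial isometries subject to relations is realized inside
the C*-algebra of bounded families `lp _ ∞` indexed by *all* families in C*-algebras that satisfy
the relations, as the C*-subalgebra generated by the tautological family. Its norm is thus the
supremum of the norms in all the families that satisfy the relations. The universe `w` is arbitrary,
so that there is no bound on the size of the C*-algebras that are taken into account. -/

/-- The closed *-subalgebra, not necessarily unital, generated by a set. -/
noncomputable def closedAdjoin {B : Type*} [NonUnitalCStarAlgebra B] (s : Set B) :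
    NonUnitalStarSubalgebra ℂ B :=
  (NonUnitalStarAlgebra.adjoin ℂ s).topologicalClosure

theorem isClosed_closedAdjoin {B : Type*} [NonUnitalCStarAlgebra B] (s : Set B) :
    IsClosed (closedAdjoin s : Set B) :=
  NonUnitalStarSubalgebra.isClosed_topologicalClosure _

theorem subset_closedAdjoin {B : Type*} [NonUnitalCStarAlgebra B] (s : Set B) :
    s ⊆ closedAdjoin s :=
  (NonUnitalStarAlgebra.subset_adjoin ℂ s).trans
    (NonUnitalStarSubalgebra.le_topologicalClosure _)

section Lp

variable {I : Type*} {A : I → Type*} [∀ i, Nontrivial (A i)] [∀ i, CStarAlgebra (A i)]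

noncomputable instance lpInftyCStarAlgebra : CStarAlgebra (lp A ∞) where

end Lp

/-- A tight representation of `S` in some nonzero unital C*-algebra. (The one in the zero algebra
would not contribute to a supremum of norms.) -/
structure TightRep (S : Type u) [Semigroupoid S] : Type (max u w + 1) where
  carrier : Type (max u w)
  [nontrivial : Nontrivial carrier]
  [cstar : CStarAlgebra carrier]
  toFun : S → carrier
  isTight : Semigroupoid.IsTightRepresentation toFun

attribute [instance] TightRep.nontrivial TightRep.cstar

section SemigroupoidAlgebra

variable (S : Type u) [Semigroupoid S]

/-- The family of all tight representations, evaluated at `f`. -/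
noncomputable def tightFamily (f : S) : lp (fun i : TightRep.{u, w} S => i.carrier) ∞ :=
  ⟨fun i => i.toFun f, memℓp_infty ⟨1, by
    rintro _ ⟨i, rfl⟩
    exact (i.isTight.partialIsometry f).norm_le_one⟩⟩

/-- The unital C*-subalgebra generated by the tautological family. -/
noncomputable def tightSubalgebra :
    StarSubalgebra ℂ (lp (fun i : TightRep.{u, w} S => i.carrier) ∞) :=
  (StarAlgebra.adjoin ℂ (Set.range (tightFamily.{u, w} S))).topologicalClosure

/-- The universal unital C*-algebra generated by a tight representation of `S`. -/
def UnitalSemigroupoidAlgebra : Type (max u w + 1) := tightSubalgebra.{u, w} S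

noncomputable instance : CStarAlgebra (UnitalSemigroupoidAlgebra.{u, w} S) :=
  StarSubalgebra.cstarAlgebra (tightSubalgebra.{u, w} S)
    (h_closed := StarSubalgebra.isClosed_topologicalClosure _)

/-- The universal tight representation. -/
noncomputable def universalTight (f : S) : UnitalSemigroupoidAlgebra.{u, w} S :=
  ⟨tightFamily.{u, w} S f,
    StarSubalgebra.le_topologicalClosure _ (StarAlgebra.subset_adjoin ℂ _ ⟨f, rfl⟩)⟩

/-- The closed *-subalgebra, not necessarily unital, that the range of the universal tight
representation generates. -/
noncomputable def semigroupoidSubalgebra :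
    NonUnitalStarSubalgebra ℂ (UnitalSemigroupoidAlgebra.{u, w} S) :=
  closedAdjoin (Set.range (universalTight.{u, w} S))

/-- The C*-algebra `𝒪(S)` of a semigroupoid. -/
def SemigroupoidAlgebra : Type (max u w + 1) := semigroupoidSubalgebra.{u, w} S

noncomputable instance : NonUnitalCStarAlgebra (SemigroupoidAlgebra.{u, w} S) :=
  NonUnitalStarSubalgebra.nonUnitalCStarAlgebra (semigroupoidSubalgebra.{u, w} S)
    (h_closed := isClosed_closedAdjoin _)

/-- The canonical generators of `𝒪(S)`. -/
noncomputable def SemigroupoidAlgebra.gen (f : S) : SemigroupoidAlgebra.{u, w} S :=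
  ⟨universalTight.{u, w} S f, subset_closedAdjoin _ ⟨f, rfl⟩⟩

end SemigroupoidAlgebra

/-! ### Categories as semigroupoids -/

/-- The set of all morphisms of a category. -/
@[ext]
structure Mor (C : Type u) [Category.{v} C] : Type (max u v) where
  /-- The domain. -/
  src : C
  /-- The co-domain. -/
  rng : C
  hom : src ⟶ rng

namespace Mor

variable {C : Type u} [Category.{v} C]

/-- The identity morphism of an object. -/
def id (x : C) : Mor C := ⟨x, x, 𝟙 x⟩

/-- The composition `fg = f ∘ g`, defined if the domain of `f` is the co-domain of `g`. -/
def comp (f g : Mor C) (h : f.src = g.rng) : Mor C :=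
  ⟨g.src, f.rng, g.hom ≫ eqToHom h.symm ≫ f.hom⟩

/-- The semigroupoid of all morphisms of a category. -/
instance : Semigroupoid (Mor C) where
  Composable f g := f.src = g.rng
  mul := comp
  assoc := by
    rintro ⟨a, b, f⟩ ⟨c, d, g⟩ ⟨e, e', h⟩ H
    have H' : a = d ∧ c = e' := by
      rcases H with H | ⟨h₁, h₂⟩ | ⟨h₁, h₂⟩
      · exact H
      · exact ⟨h₁, h₂⟩
      · exact ⟨h₂, h₁⟩
    obtain ⟨rfl, rfl⟩ := H'
    refine ⟨rfl, rfl, rfl, rfl, ?_⟩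
    change (⟨e, b, h ≫ 𝟙 c ≫ g ≫ 𝟙 a ≫ f⟩ : Mor C) = ⟨e, b, (h ≫ 𝟙 c ≫ g) ≫ 𝟙 a ≫ f⟩
    simp

end Mor

/-! ### Higher-rank graphs -/

/-- The structure of a `k`-graph on a category: a degree functor to the monoid `ℕᵏ` with the unique
factorization property. -/
structure KGraph (k : ℕ) (C : Type u) [Category.{v} C] where
  deg : Mor C → (Fin k → ℕ)
  deg_id : ∀ x : C, deg (Mor.id x) = 0
  deg_comp : ∀ (f g : Mor C) (h : f.src = g.rng), deg (f.comp g h) = deg f + deg g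
  factorization : ∀ (f : Mor C) (m n : Fin k → ℕ), deg f = m + n →
    ∃! p : Mor C × Mor C, deg p.1 = m ∧ deg p.2 = n ∧
      ∃ h : p.1.src = p.2.rng, p.1.comp p.2 h = f

namespace KGraph

variable {k : ℕ} {C : Type u} [Category.{v} C] (Λ : KGraph k C)

/-- The morphisms of degree `n` with co-domain `x`. -/
def paths (x : C) (n : Fin k → ℕ) : Set (Mor C) :=
  {f | f.rng = x ∧ Λ.deg f = n}

def RowFinite : Prop := ∀ x n, (Λ.paths x n).Finite

def NoSources : Prop := ∀ x n, (Λ.paths x n).Nonempty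

/-- A family of partial isometries in a C*-algebra, not necessarily unital, that satisfies the
defining relations of the C*-algebra of a `k`-graph. -/
structure IsKPFamily {B : Type*} [NonUnitalCStarAlgebra B] (T : Mor C → B) : Prop where
  partialIsometry : ∀ f, IsPartialIsometry (T f)
  projection : ∀ x : C, IsStarProjection (T (Mor.id x))
  orthogonal : ∀ x y : C, x ≠ y → T (Mor.id x) * T (Mor.id y) = 0
  map_comp : ∀ (f g : Mor C) (h : f.src = g.rng), T (f.comp g h) = T f * T g
  star_mul_self : ∀ f : Mor C, star (T f) * T f = T (Mor.id f.src)
  sum_final : ∀ (x : C) (n : Fin k → ℕ) (h : (Λ.paths x n).Finite),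
    T (Mor.id x) = ∑ f ∈ h.toFinset, T f * star (T f)

/-- A family in some C*-algebra that satisfies the defining relations. -/
structure KPFamily : Type (max u v w + 1) where
  carrier : Type (max u v w)
  [cstar : NonUnitalCStarAlgebra carrier]
  toFun : Mor C → carrier
  isKP : Λ.IsKPFamily toFun

attribute [instance] KPFamily.cstar

/-- The family of all families that satisfy the defining relations, evaluated at `f`. -/
noncomputable def kpFamily (f : Mor C) : lp (fun i : KPFamily.{u, v, w} Λ => i.carrier) ∞ :=
  ⟨fun i => i.toFun f, memℓp_infty ⟨1, by
    rintro _ ⟨i, rfl⟩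
    exact (i.isKP.partialIsometry f).norm_le_one⟩⟩

/-- The C*-subalgebra generated by the tautological family. -/
noncomputable def kpSubalgebra :
    NonUnitalStarSubalgebra ℂ (lp (fun i : KPFamily.{u, v, w} Λ => i.carrier) ∞) :=
  closedAdjoin (Set.range (kpFamily.{u, v, w} Λ))

/-- The C*-algebra `C*(Λ)` of a `k`-graph: the universal C*-algebra for the defining relations. -/
def GraphAlgebra : Type (max u v w + 1) := kpSubalgebra.{u, v, w} Λ

noncomputable instance : NonUnitalCStarAlgebra (GraphAlgebra.{u, v, w} Λ) :=
  NonUnitalStarSubalgebra.nonUnitalCStarAlgebra (kpSubalgebra.{u, v, w} Λ)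
    (h_closed := isClosed_closedAdjoin _)

/-- The canonical generators of `C*(Λ)`. -/
noncomputable def gen (f : Mor C) : GraphAlgebra.{u, v, w} Λ :=
  ⟨kpFamily.{u, v, w} Λ f, subset_closedAdjoin _ ⟨f, rfl⟩⟩

end KGraph

/-! ### The universal properties

The canonical generators satisfy the relations, and every family that satisfies the relations is the
image of the canonical generators under a unique homomorphism. -/

section UniversalProperty

open scoped CStarAlgebra

theorem joinList_map {A B : Type*} [Ring A] [Ring B] (φ : A →+* B) (l : List A) :
    φ (Semigroupoid.joinList l) = Semigroupoid.joinList (l.map φ) := by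
  induction l with
  | nil => simp [Semigroupoid.joinList]
  | cons a l ih => simp [Semigroupoid.joinList, ih]

variable (S : Type u) [Semigroupoid S]

/-- The evaluation at one tight representation. -/
noncomputable def evalTight (i : TightRep.{u, w} S) :
    UnitalSemigroupoidAlgebra.{u, w} S →⋆ₐ[ℂ] i.carrier where
  toFun x := x.1 i
  map_one' := rfl
  map_mul' _ _ := rfl
  map_zero' := rfl
  map_add' _ _ := rfl
  commutes' _ := rfl
  map_star' _ := rfl

theorem evalTight_ext {x y : UnitalSemigroupoidAlgebra.{u, w} S}
    (h : ∀ i, evalTight S i x = evalTight S i y) : x = y :=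
  Subtype.ext (lp.ext (funext h))

theorem evalTight_gen (i : TightRep.{u, w} S) (f : S) :
    evalTight S i (universalTight.{u, w} S f) = i.toFun f := rfl

theorem universalTight_isTight :
    Semigroupoid.IsTightRepresentation (universalTight.{u, w} S) where
  partialIsometry f := evalTight_ext S fun i => by
    simpa [evalTight_gen, map_star] using! i.isTight.partialIsometry f
  map_mul f g h := evalTight_ext S fun i => by
    simpa [evalTight_gen, map_star] using i.isTight.map_mul f g h
  mul_eq_zero f g h := evalTight_ext S fun i => by
    simpa [evalTight_gen, map_star] using i.isTight.mul_eq_zero f g h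
  commute_initial_initial f g := evalTight_ext S fun i => by
    simpa [evalTight_gen, map_star] using (i.isTight.commute_initial_initial f g).eq
  commute_initial_final f g := evalTight_ext S fun i => by
    simpa [evalTight_gen, map_star] using (i.isTight.commute_initial_final f g).eq
  commute_final_final f g := evalTight_ext S fun i => by
    simpa [evalTight_gen, map_star] using (i.isTight.commute_final_final f g).eq
  final_mul_final f g h := evalTight_ext S fun i => by
    simpa [evalTight_gen, map_star] using i.isTight.final_mul_final f g h
  initial_mul_final f g h := evalTight_ext S fun i => by
    simpa [evalTight_gen, map_star] using i.isTight.initial_mul_final f g h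
  tight F G H h := evalTight_ext S fun i => by
    have e : ∀ f, evalTight S i (Semigroupoid.initialProj (universalTight.{u, w} S) f)
        = Semigroupoid.initialProj i.toFun f := by
      rintro (_ | f)
      · exact map_one (evalTight S i)
      · simp [Semigroupoid.initialProj, evalTight_gen, map_star]
    have := joinList_map (evalTight S i : _ →+* i.carrier)
      (H.toList.map fun h => universalTight.{u, w} S h * star (universalTight.{u, w} S h))
    rw [RingHom.coe_coe] at this
    rw [this, map_mul, map_list_prod, map_list_prod]
    simpa [Function.comp_def, e, evalTight_gen, map_star] using i.isTight.tight F G H h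

/-- The universal property. -/
theorem existsUnique_lift_tight {B : Type (max u w)} [CStarAlgebra B] {T : S → B}
    (hT : Semigroupoid.IsTightRepresentation T) :
    ∃! φ : UnitalSemigroupoidAlgebra.{u, w} S →⋆ₐ[ℂ] B,
      ∀ f, φ (universalTight.{u, w} S f) = T f := by
  refine existsUnique_of_exists_of_unique ?_ ?_
  · rcases subsingleton_or_nontrivial B with hB | hB
    · exact ⟨{ toFun := fun _ => 0, map_one' := Subsingleton.elim _ _,
               map_mul' := fun _ _ => Subsingleton.elim _ _
               map_zero' := rfl, map_add' := fun _ _ => Subsingleton.elim _ _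
               commutes' := fun _ => Subsingleton.elim _ _
               map_star' := fun _ => Subsingleton.elim _ _ }, fun _ => Subsingleton.elim _ _⟩
    · exact ⟨evalTight S (TightRep.mk.{u, w} B T hT), fun f => rfl⟩
  · intro φ ψ hφ hψ
    have hc : ∀ χ : UnitalSemigroupoidAlgebra.{u, w} S →⋆ₐ[ℂ] B, Continuous χ :=
      fun χ => AddMonoidHomClass.continuous_of_bound χ 1
        (by simpa using! NonUnitalStarAlgHom.norm_apply_le χ)
    refine StarAlgHom.ext_topologicalClosure
      (S := StarAlgebra.adjoin ℂ (Set.range (tightFamily.{u, w} S)))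
      (hc φ) (hc ψ) ?_
    refine StarAlgHom.ext_adjoin ?_
    rintro ⟨_, hx⟩ ⟨f, rfl⟩
    exact (hφ f).trans (hψ f).symm

end UniversalProperty

namespace KGraph

open scoped CStarAlgebra

variable {k : ℕ} {C : Type u} [Category.{v} C] (Λ : KGraph k C)

/-- The evaluation at one family. -/
noncomputable def evalKP (i : KPFamily.{u, v, w} Λ) :
    GraphAlgebra.{u, v, w} Λ →⋆ₙₐ[ℂ] i.carrier where
  toFun x := x.1 i
  map_mul' _ _ := rfl
  map_zero' := rfl
  map_add' _ _ := rfl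
  map_smul' _ _ := rfl
  map_star' _ := rfl

theorem evalKP_ext {x y : GraphAlgebra.{u, v, w} Λ}
    (h : ∀ i, Λ.evalKP i x = Λ.evalKP i y) : x = y :=
  Subtype.ext (lp.ext (funext h))

theorem evalKP_gen (i : KPFamily.{u, v, w} Λ) (f : Mor C) :
    Λ.evalKP i (gen.{u, v, w} Λ f) = i.toFun f := rfl

theorem gen_isKP : Λ.IsKPFamily (gen.{u, v, w} Λ) where
  partialIsometry f := evalKP_ext Λ fun i => by
    simpa [evalKP_gen, map_star] using! i.isKP.partialIsometry f
  projection x := ⟨evalKP_ext Λ fun i => by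
      simpa [evalKP_gen, map_star] using (i.isKP.projection x).isIdempotentElem.eq,
    evalKP_ext Λ fun i => by
      simpa [evalKP_gen, map_star] using (i.isKP.projection x).isSelfAdjoint.star_eq⟩
  orthogonal x y h := evalKP_ext Λ fun i => by
    simpa [evalKP_gen, map_star] using i.isKP.orthogonal x y h
  map_comp f g h := evalKP_ext Λ fun i => by
    simpa [evalKP_gen, map_star] using i.isKP.map_comp f g h
  star_mul_self f := evalKP_ext Λ fun i => by
    simpa [evalKP_gen, map_star] using i.isKP.star_mul_self f
  sum_final x n h := evalKP_ext Λ fun i => by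
    simpa [evalKP_gen, map_star] using i.isKP.sum_final x n h

/-- The universal property. -/
theorem existsUnique_lift_KP {B : Type (max u v w)} [NonUnitalCStarAlgebra B] {T : Mor C → B}
    (hT : Λ.IsKPFamily T) :
    ∃! φ : GraphAlgebra.{u, v, w} Λ →⋆ₙₐ[ℂ] B, ∀ f, φ (gen.{u, v, w} Λ f) = T f := by
  refine existsUnique_of_exists_of_unique ⟨evalKP Λ (KPFamily.mk.{u, v, w} B T hT), fun f => rfl⟩ ?_
  intro φ ψ hφ hψ
  have hA : NonUnitalStarAlgebra.adjoin ℂ (Set.range (kpFamily.{u, v, w} Λ)) ≤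
      kpSubalgebra.{u, v, w} Λ := NonUnitalStarSubalgebra.le_topologicalClosure _
  have key : ∀ x (hx : x ∈ NonUnitalStarAlgebra.adjoin ℂ (Set.range (kpFamily.{u, v, w} Λ))),
      φ ⟨x, hA hx⟩ = ψ ⟨x, hA hx⟩ := by
    intro x hx
    induction hx using NonUnitalStarAlgebra.adjoin_induction with
    | mem x hx =>
      obtain ⟨f, rfl⟩ := hx
      exact (hφ f).trans (hψ f).symm
    | add x y hx hy h₁ h₂ =>
      have e (χ : GraphAlgebra.{u, v, w} Λ →⋆ₙₐ[ℂ] B) := map_add χ ⟨x, hA hx⟩ ⟨y, hA hy⟩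
      exact (e φ).trans ((congrArg₂ (· + ·) h₁ h₂).trans (e ψ).symm)
    | zero => exact (map_zero φ).trans (map_zero ψ).symm
    | mul x y hx hy h₁ h₂ =>
      have e (χ : GraphAlgebra.{u, v, w} Λ →⋆ₙₐ[ℂ] B) := map_mul χ ⟨x, hA hx⟩ ⟨y, hA hy⟩
      exact (e φ).trans ((congrArg₂ (· * ·) h₁ h₂).trans (e ψ).symm)
    | smul c x hx h =>
      have e (χ : GraphAlgebra.{u, v, w} Λ →⋆ₙₐ[ℂ] B) := map_smul χ c ⟨x, hA hx⟩
      exact (e φ).trans ((congrArg (c • ·) h).trans (e ψ).symm)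
    | star x hx h =>
      have e (χ : GraphAlgebra.{u, v, w} Λ →⋆ₙₐ[ℂ] B) := map_star χ ⟨x, hA hx⟩
      exact (e φ).trans ((congrArg star h).trans (e ψ).symm)
  have hd : DenseRange (Set.inclusion hA) := by
    refine (denseRange_inclusion_iff (SetLike.coe_subset_coe.mpr hA)).mpr ?_
    exact subset_rfl
  refine DFunLike.ext' (Continuous.ext_on hd (map_continuous φ) (map_continuous ψ) ?_)
  rintro _ ⟨⟨x, hx⟩, rfl⟩
  exact key x hx

end KGraph

/-! ### Joins and products of commuting elements -/

namespace Semigroupoid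

section Ring

variable {B ι : Type*} [Ring B]

/-! The graph relations and tightness of a representation turn out to be nearly the same condition,
and tightness does not mention a degree. Write `P_f` and `Q_f` for final and initial projections.

From tight to graph relations (`isKPFamily_of_isTight`): the identities become projections with `Q_f
= T_{s(f)}`. The paths of degree `n` into `x` cover everything composable with `id x`, since sources
are absent. Two distinct ones never intersect, by unique factorization, so the join in the tightness
condition is the sum in relation (iv).

From graph relations to tight (`isTightRepresentation`): relation (iv) makes final projections of
equal degree orthogonal. Any two `P_f`, `P_g` are refined to a common degree, which gives
commutation and the vanishing of `P_f P_g` when there is no common multiple. For a finite covering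
`H` of a cylinder, let `J` be the join and `E` the product of the `Q_f` and `1 - Q_g`. Refining a
vertex of the cylinder to a degree above those of all members of `H` yields multiples of members of
`H`; hence `J` and `E` agree on every vertex projection. This forces `J = E` unless there are
finitely many objects, where the vertex projections must also add up to `1`.

Accordingly, every graph family becomes tight in the unitization if there are infinitely many
objects, and in the corner of the sum of the vertex projections otherwise. So the canonical map from
the graph algebra to the semigroupoid algebra is injective; it is then isometric with closed range,
hence surjective. -/

theorem joinList_eq_sum (p : ι → B) (l : List ι) (h : l.Pairwise fun a b => p a * p b = 0) :
    joinList (l.map p) = (l.map p).sum := by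
  induction l with
  | nil => simp [joinList]
  | cons a l ih =>
    rw [List.pairwise_cons] at h
    have h0 : p a * (l.map p).sum = 0 := by
      rw [← List.sum_map_mul_left]
      exact List.sum_eq_zero (by simpa using h.1)
    simp [joinList, ih h.2, h0]

theorem commute_joinList {p : B} {l : List B} (h : ∀ q ∈ l, Commute p q) :
    Commute p (joinList l) := by
  induction l with
  | nil => exact Commute.zero_right p
  | cons a l ih =>
    simp only [List.forall_mem_cons] at h
    exact (h.1.add_right (ih h.2)).sub_right (h.1.mul_right (ih h.2))

theorem mul_joinList_of_mem {p : B} {l : List B} (hp : p * p = p) (h : ∀ q ∈ l, Commute p q)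
    (hl : p ∈ l) : p * joinList l = p := by
  induction l with
  | nil => simp at hl
  | cons a l ih =>
    simp only [List.forall_mem_cons] at h
    rcases List.mem_cons.mp hl with rfl | hl
    · simp [joinList, mul_add, mul_sub, ← mul_assoc, hp]
    · have e := ih h.2 hl
      simp only [joinList, mul_add, mul_sub, e]
      rw [← mul_assoc, h.1.eq, mul_assoc, e]
      abel

theorem mul_joinList_eq_self {p : B} {l : List B} (h : ∀ q ∈ l, p * q = q) :
    p * joinList l = joinList l := by
  induction l with
  | nil => simp [joinList]
  | cons a l ih =>
    simp only [List.forall_mem_cons] at h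
    simp only [joinList, mul_add, mul_sub, ← mul_assoc, ih h.2, h.1]

theorem list_prod_mul_eq_self {t : B} {l : List B} (h : ∀ q ∈ l, q * t = t) :
    l.prod * t = t := by
  induction l with
  | nil => simp
  | cons a l ih =>
    simp only [List.forall_mem_cons] at h
    rw [List.prod_cons, mul_assoc, ih h.2, h.1]

theorem mul_list_prod_of_mem {p : B} {l : List B} (hp : p * p = p) (h : ∀ q ∈ l, Commute p q)
    (hl : p ∈ l) : p * l.prod = l.prod := by
  induction l with
  | nil => simp at hl
  | cons a l ih =>
    simp only [List.forall_mem_cons] at h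
    rcases List.mem_cons.mp hl with rfl | hl
    · rw [List.prod_cons, ← mul_assoc, hp]
    · rw [List.prod_cons, ← mul_assoc, h.1.eq, mul_assoc, ih h.2 hl]

theorem list_prod_mul_eq_zero {t : B} {l : List B} (h : ∀ q ∈ l, q * t = t ∨ q * t = 0)
    (h0 : ∃ q ∈ l, q * t = 0) : l.prod * t = 0 := by
  -- The tail of the product fixes or kills `t`, so a killing factor at the head still meets `t` or
  -- `0`; no commutation is needed.
  have key : ∀ l : List B, (∀ q ∈ l, q * t = t ∨ q * t = 0) → l.prod * t = t ∨ l.prod * t = 0 := by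
    intro l h
    induction l with
    | nil => simp
    | cons a l ih =>
      simp only [List.forall_mem_cons] at h
      rw [List.prod_cons, mul_assoc]
      rcases ih h.2 with e | e <;> simp [e, h.1]
  induction l with
  | nil => simp at h0
  | cons a l ih =>
    simp only [List.forall_mem_cons] at h
    rw [List.prod_cons, mul_assoc]
    simp only [List.exists_mem_cons_iff] at h0
    rcases h0 with h0 | h0
    · rcases key l h.2 with e | e <;> simp [e, h0]
    · rw [ih h.2 h0, mul_zero]

end Ring

end Semigroupoid

/-- Projections whose sum is a projection that dominates each of them are mutually orthogonal. -/
theorem IsStarProjection.mul_eq_zero_of_sum {B ι : Type*} [NonUnitalCStarAlgebra B]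
    {s : Finset ι} {p : ι → B} (hp : ∀ i ∈ s, IsStarProjection (p i))
    (hs : ∀ i ∈ s, (∑ j ∈ s, p j) * p i = p i) {i j : ι} (hi : i ∈ s) (hj : j ∈ s) (hij : i ≠ j) :
    p i * p j = 0 := by
  classical
  let _ := CStarAlgebra.spectralOrder B
  have _ := CStarAlgebra.spectralOrderedRing B
  have e : ∀ i ∈ s, star (p i * p j) * (p i * p j) = p j * (p i * p j) := fun i hi => by
    rw [star_mul, (hp i hi).isSelfAdjoint.star_eq, (hp j hj).isSelfAdjoint.star_eq, mul_assoc,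
      ← mul_assoc (p i), (hp i hi).isIdempotentElem.eq]
  -- The sum is `p j * (∑ p i) * p j = p j`, and the term `i = j` alone is already `p j`. The other
  -- terms are positive with sum `0`, so each vanishes.
  have h1 : ∑ i ∈ s, star (p i * p j) * (p i * p j) = p j := by
    rw [Finset.sum_congr rfl e, ← Finset.mul_sum, ← Finset.sum_mul, hs j hj,
      (hp j hj).isIdempotentElem.eq]
  have h2 : ∑ i ∈ s.erase j, star (p i * p j) * (p i * p j) = 0 := by
    rw [← Finset.add_sum_erase s _ hj, e j hj, (hp j hj).isIdempotentElem.eq,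
      (hp j hj).isIdempotentElem.eq] at h1
    simpa using h1
  have h3 := (Finset.sum_eq_zero_iff_of_nonneg fun i _ => star_mul_self_nonneg (p i * p j)).mp h2 i
    (Finset.mem_erase.mpr ⟨hij, hi⟩)
  exact (CStarRing.star_mul_self_eq_zero_iff _).mp h3

/-! ### Morphisms of a category -/

namespace Mor

open Semigroupoid

variable {C : Type u} [Category.{v} C]

theorem comp_id (f : Mor C) : f.comp (Mor.id f.src) rfl = f := by
  cases f; simp [comp, Mor.id]

theorem id_comp (f : Mor C) : (Mor.id f.rng).comp f rfl = f := by
  obtain ⟨x, y, f⟩ := f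
  change (⟨x, y, f ≫ 𝟙 y ≫ 𝟙 y⟩ : Mor C) = ⟨x, y, f⟩
  simp

theorem comp_assoc (f g h : Mor C) (hfg : f.src = g.rng) (hgh : g.src = h.rng) :
    (f.comp g hfg).comp h hgh = f.comp (g.comp h hgh) hfg := by
  simp [comp]

/-- Identities make the clause `f = g` in the definition of divisibility redundant. -/
theorem divides_iff {f g : Mor C} :
    Divides f g ↔ ∃ (h : Mor C) (hc : f.src = h.rng), f.comp h hc = g := by
  refine ⟨?_, Or.inr⟩
  rintro (rfl | h)
  · exact ⟨_, rfl, comp_id f⟩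
  · exact h

theorem divides_comp (f g : Mor C) (h : f.src = g.rng) : Divides f (f.comp g h) :=
  divides_iff.mpr ⟨g, h, rfl⟩

theorem rng_eq_of_intersects {f g : Mor C} (h : Intersects f g) : f.rng = g.rng := by
  obtain ⟨m, hf, hg⟩ := h
  obtain ⟨a, ha, rfl⟩ := divides_iff.mp hf
  obtain ⟨b, hb, e⟩ := divides_iff.mp hg
  exact (congrArg Mor.rng e).symm

/-- Composability on the left depends on the co-domain only, so a cylinder amounts to a set of
objects. -/
theorem mem_cylinder_iff {F G : Finset (Option (Mor C))} {f : Mor C} :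
    f ∈ cylinder F G ↔ Mor.id f.rng ∈ cylinder F G := by
  have h : ∀ g, f ∈ rightSet g ↔ Mor.id f.rng ∈ rightSet g := fun g => by cases g <;> exact Iff.rfl
  simp only [cylinder, Set.mem_ofPred_eq, h]

end Mor

/-! ### Divisibility in higher-rank graphs -/

namespace KGraph

open Semigroupoid

variable {k : ℕ} {C : Type u} [Category.{v} C] (Λ : KGraph k C)

/-- Cancellation in `ℕᵏ` gives the cofactors equal degrees; then unique factorization applies. -/
theorem eq_of_comp_eq_comp {f f' a b : Mor C} {ha : f.src = a.rng} {hb : f'.src = b.rng}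
    (h : f.comp a ha = f'.comp b hb) (hd : Λ.deg f = Λ.deg f') : f = f' := by
  have hd' : Λ.deg a = Λ.deg b := by
    have := congrArg Λ.deg h
    rw [Λ.deg_comp, Λ.deg_comp, hd] at this
    exact add_left_cancel this
  obtain ⟨p, -, hp⟩ := Λ.factorization (f.comp a ha) (Λ.deg f) (Λ.deg a) (Λ.deg_comp f a ha)
  have h1 := hp (f, a) ⟨rfl, rfl, ha, rfl⟩
  have h2 := hp (f', b) ⟨hd.symm, hd'.symm, hb, h.symm⟩
  exact congrArg Prod.fst (h1.trans h2.symm)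

/-- Split off from `g` its initial factor of degree `deg f`. It is an initial factor of the common
multiple, as is `f`, so the two coincide. -/
theorem divides_of_intersects {f g : Mor C} (h : Intersects f g) (hd : Λ.deg f ≤ Λ.deg g) :
    Divides f g := by
  obtain ⟨m, hf, hg⟩ := h
  obtain ⟨a, ha, rfl⟩ := Mor.divides_iff.mp hf
  obtain ⟨b, hb, e⟩ := Mor.divides_iff.mp hg
  obtain ⟨⟨f', c⟩, ⟨hf', -, hc, rfl⟩, -⟩ := Λ.factorization g (Λ.deg f) (Λ.deg g - Λ.deg f)
    (add_tsub_cancel_of_le hd).symm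
  rw [Mor.comp_assoc f' c b hc hb] at e
  obtain rfl := Λ.eq_of_comp_eq_comp e hf'
  exact Mor.divides_comp _ _ _

theorem eq_of_intersects {f g : Mor C} (h : Intersects f g) (hd : Λ.deg f = Λ.deg g) : f = g := by
  obtain ⟨m, hf, hg⟩ := h
  obtain ⟨a, ha, rfl⟩ := Mor.divides_iff.mp hf
  obtain ⟨b, hb, e⟩ := Mor.divides_iff.mp hg
  exact Λ.eq_of_comp_eq_comp e.symm hd

variable {Λ}

/-- Prolong `f` at its source by a path of degree `n`; the initial factor of degree `n` of the
result is the required path. -/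
theorem NoSources.exists_intersects (hsrc : Λ.NoSources) (f : Mor C) (n : Fin k → ℕ) :
    ∃ h ∈ Λ.paths f.rng n, Intersects h f := by
  obtain ⟨g, hg, hn⟩ := hsrc f.src n
  obtain ⟨⟨h, h'⟩, ⟨hh, -, hc, e⟩, -⟩ := Λ.factorization (f.comp g hg.symm) n (Λ.deg f)
    (by rw [Λ.deg_comp, hn, add_comm])
  have hr := congrArg Mor.rng e
  exact ⟨h, ⟨hr, hh⟩, f.comp g hg.symm, Mor.divides_iff.mpr ⟨h', hc, e⟩,
    Mor.divides_comp _ _ _⟩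

theorem NoSources.isCovering_paths (hsrc : Λ.NoSources) (x : C) (n : Fin k → ℕ) :
    IsCovering (Λ.paths x n) (cylinder {some (Mor.id x)} ∅) := by
  constructor
  · rintro f ⟨hf, -⟩
    refine ⟨fun g hg => ?_, by simp⟩
    rw [Finset.mem_singleton.mp hg]
    exact hf.symm
  · intro f hf
    have hx : x = f.rng := hf.1 _ (Finset.mem_singleton_self _)
    exact hx ▸ hsrc.exists_intersects f n

/-! ### Tight representations satisfy the relations of the graph algebra -/

theorem isKPFamily_of_isTight (hsrc : Λ.NoSources) {B : Type*} [CStarAlgebra B] {T : Mor C → B}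
    (hT : IsTightRepresentation T) : Λ.IsKPFamily T := by
  have comp_eq : ∀ (f g : Mor C) (h : f.src = g.rng), T (f.comp g h) = T f * T g :=
    fun f g h => (hT.map_mul f g h).symm
  have idem : ∀ x : C, T (Mor.id x) * T (Mor.id x) = T (Mor.id x) := fun x => by
    rw [← comp_eq _ _ rfl]; exact congrArg T (Mor.comp_id (Mor.id x))
  -- For idempotent `T = T_x`, the relation `Q_x P_x = P_x` collapses to `T* T T* = T T*`, and the
  -- left side is `T*`.
  have final_eq : ∀ x : C, star (T (Mor.id x)) = T (Mor.id x) * star (T (Mor.id x)) := fun x => by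
    have h1 := hT.initial_mul_final (Mor.id x) (Mor.id x) rfl
    rw [mul_assoc, ← mul_assoc (T (Mor.id x)), idem, ← mul_assoc] at h1
    rw [← h1]
    have h2 : T (Mor.id x) * star (T (Mor.id x)) * T (Mor.id x) = T (Mor.id x) :=
      hT.partialIsometry _
    simpa [mul_assoc] using (congrArg star h2).symm
  have proj : ∀ x : C, IsStarProjection (T (Mor.id x)) := fun x => by
    refine ⟨idem x, ?_⟩
    have h := congrArg star (final_eq x)
    rw [star_star, star_mul, star_star] at h
    exact (final_eq x).trans h.symm
  have initial_eq : ∀ f : Mor C, star (T f) * T f = T (Mor.id f.src) := fun f => by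
    have h1 := hT.initial_mul_final f (Mor.id f.src) rfl
    rw [(proj _).isSelfAdjoint.star_eq, idem, mul_assoc, ← comp_eq _ _ rfl, Mor.comp_id] at h1
    exact h1
  refine ⟨hT.partialIsometry, proj, fun x y hxy => hT.mul_eq_zero _ _ hxy, comp_eq, initial_eq, ?_⟩
  intro x n h
  -- For this cylinder the right side of the tightness condition is `Q_x = T_x`.
  have ht := hT.tight {some (Mor.id x)} ∅ h.toFinset
    (by rw [Set.Finite.coe_toFinset]; exact hsrc.isCovering_paths x n)
  rw [joinList_eq_sum (fun f => T f * star (T f)), Finset.sum_map_toList] at ht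
  · rw [ht]
    simp [initialProj, (proj x).isSelfAdjoint.star_eq, idem]
  · refine (Finset.nodup_toList _).pairwise_of_forall_ne ?_
    intro f hf g hg hne
    rw [Finset.mem_toList, Set.Finite.mem_toFinset] at hf hg
    exact hT.final_mul_final f g fun hi => hne (Λ.eq_of_intersects hi (hf.2.trans hg.2.symm))

/-! ### Families that satisfy the relations of the graph algebra -/

namespace IsKPFamily

section NonUnital

variable {B : Type*} [NonUnitalCStarAlgebra B] {T : Mor C → B}

theorem mul_id (hT : Λ.IsKPFamily T) (f : Mor C) : T f * T (Mor.id f.src) = T f := by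
  rw [← hT.map_comp _ _ rfl, Mor.comp_id]

theorem id_mul (hT : Λ.IsKPFamily T) (f : Mor C) : T (Mor.id f.rng) * T f = T f := by
  rw [← hT.map_comp _ _ rfl, Mor.id_comp]

theorem mul_eq_zero (hT : Λ.IsKPFamily T) {f g : Mor C} (h : f.src ≠ g.rng) : T f * T g = 0 := by
  rw [← hT.mul_id f, ← hT.id_mul g, mul_assoc, ← mul_assoc (T (Mor.id _)), hT.orthogonal _ _ h,
    zero_mul, mul_zero]

theorem id_mul_of_ne (hT : Λ.IsKPFamily T) {x : C} {f : Mor C} (h : x ≠ f.rng) :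
    T (Mor.id x) * T f = 0 :=
  hT.mul_eq_zero (f := Mor.id x) h

theorem isStarProjection_final (hT : Λ.IsKPFamily T) (f : Mor C) :
    IsStarProjection (T f * star (T f)) := by
  refine ⟨?_, IsSelfAdjoint.mul_star_self _⟩
  have h : T f * star (T f) * T f = T f := hT.partialIsometry f
  rw [IsIdempotentElem, ← mul_assoc, h]

theorem final_mul_final_of_divides (hT : Λ.IsKPFamily T) {f g : Mor C} (h : Divides f g) :
    (T g * star (T g)) * (T f * star (T f)) = T g * star (T g) := by
  obtain ⟨a, ha, rfl⟩ := Mor.divides_iff.mp h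
  have h : T f * star (T f) * T f = T f := hT.partialIsometry f
  have e : (T f * star (T f)) * (T (f.comp a ha) * star (T (f.comp a ha))) =
      T (f.comp a ha) * star (T (f.comp a ha)) := by
    rw [hT.map_comp, ← mul_assoc, ← mul_assoc _ (T f), h]
  simpa [mul_assoc] using congrArg star e

theorem commute_id_final (hT : Λ.IsKPFamily T) (x : C) (f : Mor C) :
    Commute (T (Mor.id x)) (T f * star (T f)) := by
  have key : T (Mor.id x) * (T f * star (T f)) = T f * star (T f) ∨
      T (Mor.id x) * (T f * star (T f)) = 0 := by
    by_cases h : x = f.rng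
    · subst h; left; rw [← mul_assoc, hT.id_mul]
    · right; rw [← mul_assoc, hT.id_mul_of_ne h, zero_mul]
  have hs : star (T (Mor.id x) * (T f * star (T f))) = T f * star (T f) * T (Mor.id x) := by
    rw [star_mul, (hT.projection x).isSelfAdjoint.star_eq, star_mul, star_star]
  rw [commute_iff_eq, ← hs]
  rcases key with e | e <;> simp [e]

theorem commute_id_id (hT : Λ.IsKPFamily T) (x y : C) :
    Commute (T (Mor.id x)) (T (Mor.id y)) := by
  by_cases h : x = y
  · subst h; exact Commute.refl _
  · rw [commute_iff_eq, hT.orthogonal x y h, hT.orthogonal y x (Ne.symm h)]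

/-- With a common co-domain, both are summands in relation (iv), whose sum is a vertex projection
dominating them; with different co-domains, they lie under orthogonal vertex projections. -/
theorem final_mul_final_of_deg_eq (hT : Λ.IsKPFamily T) (hfin : Λ.RowFinite) {f g : Mor C}
    (hd : Λ.deg f = Λ.deg g) (hne : f ≠ g) : (T f * star (T f)) * (T g * star (T g)) = 0 := by
  by_cases hr : f.rng = g.rng
  · refine IsStarProjection.mul_eq_zero_of_sum (s := (hfin g.rng (Λ.deg g)).toFinset)
      (p := fun f => T f * star (T f)) (fun f _ => hT.isStarProjection_final f) ?_ ?_ ?_ hne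
    · intro i hi
      rw [Set.Finite.mem_toFinset] at hi
      rw [← hT.sum_final, ← hi.1, ← mul_assoc, hT.id_mul]
    · exact (Set.Finite.mem_toFinset _).mpr ⟨hr, hd⟩
    · exact (Set.Finite.mem_toFinset _).mpr ⟨rfl, rfl⟩
  · rw [← hT.id_mul f, star_mul, (hT.projection _).isSelfAdjoint.star_eq]
    simp only [mul_assoc]
    rw [← mul_assoc (T (Mor.id f.rng)) (T g), hT.id_mul_of_ne hr]
    simp

theorem final_eq_sum (hT : Λ.IsKPFamily T) (hfin : Λ.RowFinite) (f : Mor C) (n : Fin k → ℕ) :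
    T f * star (T f) =
      ∑ a ∈ (hfin f.src n).toFinset, (T f * T a) * star (T f * T a) := by
  have e : ∀ a, (T f * T a) * star (T f * T a) = T f * (T a * star (T a)) * star (T f) := fun a => by
    simp only [star_mul, mul_assoc]
  simp only [e]
  rw [← Finset.sum_mul, ← Finset.mul_sum, ← hT.sum_final, hT.mul_id]

/-- The final projection of `f` is a sum of final projections of multiples of `f` of any given
degree above that of `f`. -/
theorem exists_final_eq_sum (hT : Λ.IsKPFamily T) (hfin : Λ.RowFinite) (f : Mor C)
    {n : Fin k → ℕ} (hn : Λ.deg f ≤ n) :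
    ∃ s : Finset (Mor C), (∀ h ∈ s, Divides f h ∧ Λ.deg h = n) ∧
      T f * star (T f) = ∑ h ∈ s, T h * star (T h) := by
  classical
  set A := (hfin f.src (n - Λ.deg f)).toFinset with hA
  have hmem : ∀ a ∈ A, f.src = a.rng ∧ Λ.deg a = n - Λ.deg f := fun a ha => by
    rw [hA, Set.Finite.mem_toFinset] at ha
    exact ⟨ha.1.symm, ha.2⟩
  let φ : A → Mor C := fun a => f.comp a.1 (hmem a a.2).1
  -- Injectivity, by unique factorization, ensures that the sum over the image of `φ` is the sum
  -- over the paths `a`.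
  have hφ : Function.Injective φ := fun a b hab => by
    obtain ⟨p, -, hp⟩ := Λ.factorization (φ a) (Λ.deg f) (n - Λ.deg f)
      (by rw [Λ.deg_comp, (hmem a a.2).2])
    have h1 := hp (f, a) ⟨rfl, (hmem a a.2).2, _, rfl⟩
    have h2 := hp (f, b) ⟨rfl, (hmem b b.2).2, _, hab.symm⟩
    exact Subtype.ext (congrArg Prod.snd (h1.trans h2.symm))
  refine ⟨A.attach.image φ, ?_, ?_⟩
  · intro h hh
    obtain ⟨a, -, rfl⟩ := Finset.mem_image.mp hh
    exact ⟨Mor.divides_comp _ _ _,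
      by rw [Λ.deg_comp, (hmem a a.2).2, add_tsub_cancel_of_le hn]⟩
  · rw [Finset.sum_image fun a _ b _ h => hφ h, hT.final_eq_sum hfin f (n - Λ.deg f), ← hA,
      ← Finset.sum_attach]
    exact Finset.sum_congr rfl fun a _ => by rw [hT.map_comp]

/-- Refined to the degree `deg f ⊔ deg g`, both are sums of final projections of a single degree,
and these are equal or orthogonal. -/
theorem commute_final_final (hT : Λ.IsKPFamily T) (hfin : Λ.RowFinite) (f g : Mor C) :
    Commute (T f * star (T f)) (T g * star (T g)) := by
  obtain ⟨s, hs, es⟩ := hT.exists_final_eq_sum hfin f (le_sup_left : _ ≤ Λ.deg f ⊔ Λ.deg g)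
  obtain ⟨t, ht, et⟩ := hT.exists_final_eq_sum hfin g (le_sup_right : _ ≤ Λ.deg f ⊔ Λ.deg g)
  rw [es, et]
  refine Commute.sum_left _ _ _ fun a ha => Commute.sum_right _ _ _ fun b hb => ?_
  by_cases hab : a = b
  · subst hab; exact Commute.refl _
  · have hd := (hs a ha).2.trans (ht b hb).2.symm
    rw [commute_iff_eq, hT.final_mul_final_of_deg_eq hfin hd hab,
      hT.final_mul_final_of_deg_eq hfin hd.symm (Ne.symm hab)]

theorem final_mul_final_of_not_intersects (hT : Λ.IsKPFamily T) (hfin : Λ.RowFinite) {f g : Mor C}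
    (h : ¬ Intersects f g) : (T f * star (T f)) * (T g * star (T g)) = 0 := by
  obtain ⟨s, hs, es⟩ := hT.exists_final_eq_sum hfin f (le_sup_left : _ ≤ Λ.deg f ⊔ Λ.deg g)
  obtain ⟨t, ht, et⟩ := hT.exists_final_eq_sum hfin g (le_sup_right : _ ≤ Λ.deg f ⊔ Λ.deg g)
  rw [es, et, Finset.sum_mul_sum]
  refine Finset.sum_eq_zero fun a ha => Finset.sum_eq_zero fun b hb => ?_
  refine hT.final_mul_final_of_deg_eq hfin ((hs a ha).2.trans (ht b hb).2.symm) ?_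
  -- A path occurring in both refinements would be a common multiple of `f` and `g`.
  rintro rfl
  exact h ⟨a, (hs a ha).1, (ht a hb).1⟩

end NonUnital

/-! ### Tightness of graph families in unital algebras -/

section Unital

variable {B : Type*} [CStarAlgebra B] {T : Mor C → B}

theorem isRepresentation (hT : Λ.IsKPFamily T) (hfin : Λ.RowFinite) : IsRepresentation T where
  partialIsometry := hT.partialIsometry
  map_mul f g h := (hT.map_comp f g h).symm
  mul_eq_zero f g h := hT.mul_eq_zero h
  commute_initial_initial f g := by
    rw [hT.star_mul_self, hT.star_mul_self]; exact hT.commute_id_id _ _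
  commute_initial_final f g := by
    rw [hT.star_mul_self]; exact hT.commute_id_final _ _
  commute_final_final := hT.commute_final_final hfin
  final_mul_final f g h := hT.final_mul_final_of_not_intersects hfin h
  initial_mul_final f g h := by
    have h : f.src = g.rng := h
    rw [hT.star_mul_self, h, ← mul_assoc, hT.id_mul]

/-- The projection `∏ Q_f ∏ (1 - Q_g)` that belongs to a cylinder. -/
noncomputable def cylinderProj (T : Mor C → B) (F G : Finset (Option (Mor C))) : B :=
  (F.toList.map fun f => initialProj T f).prod *
    (G.toList.map fun g => 1 - initialProj T g).prod

theorem initialProj_mul_id (hT : Λ.IsKPFamily T) {f : Option (Mor C)} {x : C}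
    (h : Mor.id x ∈ rightSet f) : initialProj T f * T (Mor.id x) = T (Mor.id x) := by
  cases f with
  | none => exact one_mul _
  | some f =>
    have h : f.src = x := h
    rw [initialProj, hT.star_mul_self, h]
    exact (hT.projection x).isIdempotentElem

theorem initialProj_mul_id_of_notMem (hT : Λ.IsKPFamily T) {f : Option (Mor C)} {x : C}
    (h : Mor.id x ∉ rightSet f) : initialProj T f * T (Mor.id x) = 0 := by
  cases f with
  | none => exact absurd trivial h
  | some f =>
    have h : f.src ≠ x := h
    rw [initialProj, hT.star_mul_self]
    exact hT.orthogonal _ _ h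

theorem commute_id_initialProj (hT : Λ.IsKPFamily T) (x : C) (f : Option (Mor C)) :
    Commute (T (Mor.id x)) (initialProj T f) := by
  cases f with
  | none => exact Commute.one_right _
  | some f => rw [initialProj, hT.star_mul_self]; exact hT.commute_id_id _ _

/-- The projection of a cylinder acts as the identity on the vertices of the cylinder. -/
theorem cylinderProj_mul_id (hT : Λ.IsKPFamily T) {F G : Finset (Option (Mor C))} {x : C}
    (h : Mor.id x ∈ cylinder F G) : cylinderProj T F G * T (Mor.id x) = T (Mor.id x) := by
  rw [cylinderProj, ← List.prod_append]
  apply list_prod_mul_eq_self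
  simp only [List.mem_append, List.mem_map, Finset.mem_toList]
  rintro q (⟨f, hf, rfl⟩ | ⟨g, hg, rfl⟩)
  · exact hT.initialProj_mul_id (h.1 f hf)
  · rw [sub_mul, hT.initialProj_mul_id_of_notMem (h.2 g hg), one_mul, sub_zero]

theorem cylinderProj_mul_id_of_notMem (hT : Λ.IsKPFamily T) {F G : Finset (Option (Mor C))} {x : C}
    (h : Mor.id x ∉ cylinder F G) :
    cylinderProj T F G * T (Mor.id x) = 0 := by
  rw [cylinderProj, ← List.prod_append]
  apply list_prod_mul_eq_zero
  · simp only [List.mem_append, List.mem_map, Finset.mem_toList]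
    rintro q (⟨f, -, rfl⟩ | ⟨g, -, rfl⟩)
    · by_cases hf : Mor.id x ∈ rightSet f
      · exact Or.inl (hT.initialProj_mul_id hf)
      · exact Or.inr (hT.initialProj_mul_id_of_notMem hf)
    · rw [sub_mul, one_mul]
      by_cases hg : Mor.id x ∈ rightSet g
      · right; rw [hT.initialProj_mul_id hg, sub_self]
      · left; rw [hT.initialProj_mul_id_of_notMem hg, sub_zero]
  · by_cases hF : ∀ f ∈ F, Mor.id x ∈ rightSet f
    · have hG : ∃ g ∈ G, Mor.id x ∈ rightSet g := by
        by_contra! hG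
        exact h ⟨hF, hG⟩
      obtain ⟨g, hg, hx⟩ := hG
      refine ⟨1 - initialProj T g, ?_, ?_⟩
      · simp only [List.mem_append, List.mem_map, Finset.mem_toList]
        exact Or.inr ⟨g, hg, rfl⟩
      · rw [sub_mul, hT.initialProj_mul_id hx, one_mul, sub_self]
    · push Not at hF
      obtain ⟨f, hf, hx⟩ := hF
      refine ⟨initialProj T f, ?_, hT.initialProj_mul_id_of_notMem hx⟩
      simp only [List.mem_append, List.mem_map, Finset.mem_toList]
      exact Or.inl ⟨f, hf, rfl⟩

/-- The final projections of a covering of a cylinder dominate the vertices of the cylinder. -/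
theorem id_mul_joinList (hT : Λ.IsKPFamily T) (hfin : Λ.RowFinite)
    {F G : Finset (Option (Mor C))} {H : Finset (Mor C)}
    (hH : IsCovering (H : Set (Mor C)) (cylinder F G)) {x : C} (hx : Mor.id x ∈ cylinder F G) :
    T (Mor.id x) * joinList (H.toList.map fun h => T h * star (T h)) = T (Mor.id x) := by
  -- The degree of `μ` exceeds that of every member of `H`, so a member `h` that intersects `μ`
  -- divides it, and `P_μ ≤ P_h ≤ J`.
  have key : ∀ μ ∈ (hfin x (H.sup Λ.deg)).toFinset,
      (T μ * star (T μ)) * joinList (H.toList.map fun h => T h * star (T h)) =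
        T μ * star (T μ) := by
    intro μ hμ
    obtain ⟨hr, hd⟩ := (Set.Finite.mem_toFinset _).mp hμ
    have hμ' : μ ∈ cylinder F G := Mor.mem_cylinder_iff.mpr (hr ▸ hx)
    obtain ⟨h, hh, hi⟩ := hH.2 μ hμ'
    have hdiv := Λ.divides_of_intersects hi (hd ▸ Finset.le_sup (f := Λ.deg) hh)
    rw [← hT.final_mul_final_of_divides hdiv, mul_assoc, mul_joinList_of_mem]
    · exact hT.isStarProjection_final h |>.isIdempotentElem
    · simp only [List.mem_map, Finset.mem_toList, forall_exists_index, and_imp,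
        forall_apply_eq_imp_iff₂]
      exact fun g _ => hT.commute_final_final hfin h g
    · exact List.mem_map.mpr ⟨h, Finset.mem_toList.mpr hh, rfl⟩
  rw [hT.sum_final x _ (hfin x (H.sup Λ.deg)), Finset.sum_mul]
  exact Finset.sum_congr rfl key

/-- A family that satisfies the relations of the graph algebra is a tight representation if it is
nondegenerate or the set of objects is infinite. -/
theorem isTightRepresentation (hT : Λ.IsKPFamily T) (hfin : Λ.RowFinite)
    (hC : Finite C → ∀ a : B, (∀ x, a * T (Mor.id x) = 0) → a = 0) : IsTightRepresentation T where
  toIsRepresentation := hT.isRepresentation hfin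
  tight F G H hH := by
    classical
    have hmem := fun x => hT.cylinderProj_mul_id (F := F) (G := G) (x := x)
    have hnot := fun x => hT.cylinderProj_mul_id_of_notMem (F := F) (G := G) (x := x)
    have hcomm : ∀ x, Commute (T (Mor.id x)) (cylinderProj T F G) := fun x => by
      refine Commute.mul_right (Commute.list_prod_right _ _ ?_) (Commute.list_prod_right _ _ ?_)
      · simp only [List.mem_map, forall_exists_index, and_imp, forall_apply_eq_imp_iff₂]
        exact fun f _ => hT.commute_id_initialProj x f
      · simp only [List.mem_map, forall_exists_index, and_imp, forall_apply_eq_imp_iff₂]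
        exact fun f _ => (Commute.one_right _).sub_right (hT.commute_id_initialProj x f)
    have hF : ∀ f, some f ∈ F → T (Mor.id f.src) * (cylinderProj T F G) = cylinderProj T F G := fun f hf => by
      suffices h : T (Mor.id f.src) * (F.toList.map fun f => initialProj T f).prod =
          (F.toList.map fun f => initialProj T f).prod by
        rw [cylinderProj, ← mul_assoc, h]
      apply mul_list_prod_of_mem
      · exact (hT.projection _).isIdempotentElem
      · simp only [List.mem_map, forall_exists_index, and_imp, forall_apply_eq_imp_iff₂]
        exact fun g _ => hT.commute_id_initialProj _ g
      · exact List.mem_map.mpr ⟨some f, Finset.mem_toList.mpr hf, hT.star_mul_self f⟩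
    have hG : none ∈ G → (G.toList.map fun g => 1 - initialProj T g).prod = 0 := fun h => by
      apply List.prod_eq_zero
      exact List.mem_map.mpr ⟨none, Finset.mem_toList.mpr h, sub_self _⟩
    have hJ := fun x => hT.id_mul_joinList hfin hH (x := x)
    have hJc : ∀ x, Commute (T (Mor.id x)) (joinList (H.toList.map fun h => T h * star (T h))) :=
      fun x => commute_joinList (by
        simp only [List.mem_map, forall_exists_index, and_imp, forall_apply_eq_imp_iff₂]
        exact fun f _ => hT.commute_id_final x f)
    have hEJ : cylinderProj T F G *
        joinList (H.toList.map fun h => T h * star (T h)) =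
        joinList (H.toList.map fun h => T h * star (T h)) := by
      apply mul_joinList_eq_self
      simp only [List.mem_map, Finset.mem_toList, forall_exists_index, and_imp,
        forall_apply_eq_imp_iff₂]
      intro h hh
      have hx := hmem _ (Mor.mem_cylinder_iff.mp (hH.1 hh))
      rw [← mul_assoc, ← hT.id_mul h, ← mul_assoc, hx]
    change _ = cylinderProj T F G
    generalize hE : cylinderProj T F G = E at *
    generalize joinList (H.toList.map fun h => T h * star (T h)) = J at *
    -- On a vertex of the cylinder both `J` and `E` act as the identity; elsewhere `E` kills the
    -- vertex, and so does `J = E J`.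
    have hD : ∀ x, (J - E) * T (Mor.id x) = 0 := fun x => by
      rw [← hEJ, sub_mul, mul_assoc, ← (hJc x).eq, ← mul_assoc]
      by_cases hx : Mor.id x ∈ cylinder F G
      · rw [hmem x hx, hJ x hx, sub_self]
      · rw [hnot x hx, zero_mul, sub_self]
    -- If `F` contains some `f ≠ 1`, then `E` and `J` lie under `T_{s(f)}`, so agreement at this one
    -- vertex suffices.
    by_cases hsome : ∃ f, some f ∈ F
    · obtain ⟨f, hf⟩ := hsome
      have h := hD f.src
      rw [sub_mul, ← (hcomm _).eq, hF f hf, ← hEJ, mul_assoc, ← (hJc _).eq, ← mul_assoc,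
        ← (hcomm _).eq, hF f hf, hEJ] at h
      exact sub_eq_zero.mp h
    by_cases hnone : none ∈ G
    · have h0 : E = 0 := by rw [← hE, cylinderProj, hG hnone, mul_zero]
      rw [← hEJ, h0, zero_mul]
    -- Now every object is the co-domain of a member of `H` or the source of a member of `G`, so
    -- there are finitely many objects and nondegeneracy may be used.
    · refine sub_eq_zero.mp (hC ?_ _ hD)
      have hsub : (Set.univ : Set C) ⊆ (H.image Mor.rng ∪
          G.biUnion fun g => g.elim ∅ fun g => {g.src} : Finset C) := by
        intro x _
        rw [Finset.mem_coe, Finset.mem_union]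
        by_cases hx : Mor.id x ∈ cylinder F G
        · obtain ⟨h, hh, hi⟩ := hH.2 _ hx
          exact Or.inl (Finset.mem_image.mpr ⟨h, hh, Mor.rng_eq_of_intersects hi⟩)
        · right
          by_contra hx'
          refine hx ⟨fun f hf => ?_, fun g hg => ?_⟩
          · cases f with
            | none => trivial
            | some f => exact absurd ⟨f, hf⟩ hsome
          · cases g with
            | none => exact absurd hg hnone
            | some g =>
              intro (h : g.src = x)
              exact hx' (Finset.mem_biUnion.mpr ⟨some g, hg, by simp [h]⟩)
      exact Set.finite_univ_iff.mp ((Finset.finite_toSet _).subset hsub)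

end Unital

end IsKPFamily

end KGraph

/-! ### Closed *-subalgebras -/

theorem closedAdjoin_le {B : Type*} [NonUnitalCStarAlgebra B] {s : Set B}
    {K : NonUnitalStarSubalgebra ℂ B} (hK : IsClosed (K : Set B)) (hs : s ⊆ K) :
    closedAdjoin s ≤ K :=
  NonUnitalStarSubalgebra.topologicalClosure_minimal _ (NonUnitalStarAlgebra.adjoin_le hs) hK

open scoped CStarAlgebra in
/-- A star homomorphism maps `closedAdjoin s` to a closed *-subalgebra that contains the image
of `s`. -/
theorem apply_mem_of_mem_closedAdjoin {A B : Type*} [NonUnitalCStarAlgebra A]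
    [NonUnitalCStarAlgebra B] (φ : A →⋆ₙₐ[ℂ] B) {s : Set A} {K : NonUnitalStarSubalgebra ℂ B}
    (hK : IsClosed (K : Set B)) (hs : ∀ a ∈ s, φ a ∈ K) {a : A} (ha : a ∈ closedAdjoin s) :
    φ a ∈ K :=
  closedAdjoin_le (K := K.comap φ) (hK.preimage (map_continuous φ)) hs ha

/-- A closed *-subalgebra of `closedAdjoin s` that contains `s` is all of `closedAdjoin s`. -/
theorem mem_of_generators_mem {B : Type*} [NonUnitalCStarAlgebra B] {s : Set B}
    {K : NonUnitalStarSubalgebra ℂ (closedAdjoin s)} (hK : IsClosed (K : Set (closedAdjoin s)))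
    (hs : ∀ a (ha : a ∈ s), ⟨a, subset_closedAdjoin s ha⟩ ∈ K) (a : closedAdjoin s) : a ∈ K := by
  have hcl : IsClosed (K.map (NonUnitalStarSubalgebraClass.subtype (closedAdjoin s)) : Set B) :=
    (isClosed_closedAdjoin s).isClosedEmbedding_subtypeVal.isClosedMap _ hK
  obtain ⟨b, hb, e⟩ := closedAdjoin_le hcl (fun a ha => ⟨_, hs a ha, rfl⟩) a.2
  exact Subtype.ext e ▸ hb

/-- A C*-algebra that has a unit element, as a unital C*-algebra. -/
noncomputable abbrev NonUnitalCStarAlgebra.toCStarAlgebraOfUnit {A : Type*}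
    [inst : NonUnitalCStarAlgebra A] (e : A) (he : ∀ a, e * a = a) (he' : ∀ a, a * e = a) :
    CStarAlgebra A :=
  letI : Ring A := { inst with one := e, one_mul := he, mul_one := he' }
  letI : NormedRing A :=
    { (inferInstance : Ring A), inst.toNonUnitalNormedRing with }
  letI : Algebra ℂ A := Algebra.ofModule smul_mul_assoc mul_smul_comm
  letI : NormedAlgebra ℂ A := { norm_smul_le := norm_smul_le }
  { (inferInstance : NormedRing A), inst.toStarRing, (inferInstance : NormedAlgebra ℂ A) with
    complete := inst.complete
    norm_mul_self_le := inst.norm_mul_self_le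
    star_smul := inst.star_smul }

/-- The *-subalgebra of all elements on which the self-adjoint element `p` acts as a unit; if `p` is
a projection, this is the corner `pBp`. -/
def cornerSubalgebra {B : Type*} [NonUnitalCStarAlgebra B] {p : B} (hp : IsSelfAdjoint p) :
    NonUnitalStarSubalgebra ℂ B where
  carrier := {b | p * b = b ∧ b * p = b}
  add_mem' ha hb := ⟨by rw [mul_add, ha.1, hb.1], by rw [add_mul, ha.2, hb.2]⟩
  zero_mem' := ⟨mul_zero _, zero_mul _⟩
  mul_mem' ha hb := ⟨by rw [← mul_assoc, ha.1], by rw [mul_assoc, hb.2]⟩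
  smul_mem' c _ ha := ⟨by rw [mul_smul_comm, ha.1], by rw [smul_mul_assoc, ha.2]⟩
  star_mem' {a} ha := by
    refine ⟨?_, ?_⟩
    · simpa [hp.star_eq] using congrArg star ha.2
    · simpa [hp.star_eq] using congrArg star ha.1

theorem isClosed_cornerSubalgebra {B : Type*} [NonUnitalCStarAlgebra B] {p : B}
    (hp : IsSelfAdjoint p) : IsClosed (cornerSubalgebra hp : Set B) :=
  (isClosed_eq (by fun_prop) continuous_id).inter (isClosed_eq (by fun_prop) continuous_id)

/-! ### The canonical map and its bijectivity -/

namespace KGraph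

open Semigroupoid
open scoped CStarAlgebra

variable {k : ℕ} {C : Type u} [Category.{v} C] {Λ : KGraph k C}

namespace IsKPFamily

variable {A B : Type*} [NonUnitalCStarAlgebra A] [NonUnitalCStarAlgebra B]

theorem map {T : Mor C → A} (hT : Λ.IsKPFamily T) (φ : A →⋆ₙₐ[ℂ] B) :
    Λ.IsKPFamily fun f => φ (T f) where
  partialIsometry f := by
    have h : T f * star (T f) * T f = T f := hT.partialIsometry f
    rw [IsPartialIsometry, ← map_star, ← map_mul, ← map_mul, h]
  projection x := (hT.projection x).map φ
  orthogonal x y h := by rw [← map_mul, hT.orthogonal x y h, map_zero]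
  map_comp f g h := by rw [hT.map_comp f g h, map_mul]
  star_mul_self f := by rw [← map_star, ← map_mul, hT.star_mul_self]
  sum_final x n h := by simp only [← map_star, ← map_mul, ← map_sum, ← hT.sum_final x n h]

theorem of_injective {T : Mor C → A} {φ : A →⋆ₙₐ[ℂ] B} (hφ : Function.Injective φ)
    (hT : Λ.IsKPFamily fun f => φ (T f)) : Λ.IsKPFamily T where
  partialIsometry f := hφ (by
    simpa only [map_mul, map_star] using! hT.partialIsometry f)
  projection x := ⟨hφ (by simpa using (hT.projection x).isIdempotentElem.eq),
    hφ (by simpa [map_star] using (hT.projection x).isSelfAdjoint.star_eq)⟩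
  orthogonal x y h := hφ (by simpa using hT.orthogonal x y h)
  map_comp f g h := hφ (by simpa using hT.map_comp f g h)
  star_mul_self f := hφ (by simpa [map_star] using hT.star_mul_self f)
  sum_final x n h := hφ (by simpa [map_star] using hT.sum_final x n h)

end IsKPFamily

/-- A tight representation as a family that satisfies the relations of the graph algebra. -/
noncomputable def KPFamily.ofTightRep (hsrc : Λ.NoSources) (i : TightRep.{max u v, w} (Mor C)) :
    KPFamily.{u, v, w} Λ where
  carrier := i.carrier
  toFun := i.toFun
  isKP := isKPFamily_of_isTight hsrc i.isTight

/-- The restriction of bounded families to the tight representations. -/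
noncomputable def restrictTight (hsrc : Λ.NoSources) :
    lp (fun i : KPFamily.{u, v, w} Λ => i.carrier) ∞ →⋆ₙₐ[ℂ]
      lp (fun i : TightRep.{max u v, w} (Mor C) => i.carrier) ∞ where
  -- The target lies in a universe above that of the families, beyond the reach of
  -- `existsUnique_lift_KP`; the map is instead a re-indexing of bounded families, which keeps every
  -- bound.
  toFun x := ⟨fun i => x.1 (KPFamily.ofTightRep hsrc i), memℓp_infty (by
    obtain ⟨c, hc⟩ := memℓp_infty_iff.mp x.2
    exact ⟨c, by rintro _ ⟨i, rfl⟩; exact hc ⟨KPFamily.ofTightRep hsrc i, rfl⟩⟩)⟩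
  map_mul' _ _ := rfl
  map_zero' := rfl
  map_add' _ _ := rfl
  map_smul' _ _ := rfl
  map_star' _ := rfl

theorem restrictTight_mem (hsrc : Λ.NoSources) (x : GraphAlgebra.{u, v, w} Λ) :
    restrictTight hsrc x.1 ∈ tightSubalgebra.{max u v, w} (Mor C) := by
  refine apply_mem_of_mem_closedAdjoin (restrictTight hsrc)
    (K := (tightSubalgebra.{max u v, w} (Mor C)).toNonUnitalStarSubalgebra)
    (StarSubalgebra.isClosed_topologicalClosure _) ?_ x.2
  rintro _ ⟨f, rfl⟩
  exact (universalTight.{max u v, w} (Mor C) f).2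

/-- The homomorphism from the graph algebra to the universal unital C*-algebra of a tight
representation. -/
noncomputable def toUnital (hsrc : Λ.NoSources) :
    GraphAlgebra.{u, v, w} Λ →⋆ₙₐ[ℂ] UnitalSemigroupoidAlgebra.{max u v, w} (Mor C) where
  toFun x := ⟨restrictTight hsrc x.1, restrictTight_mem hsrc x⟩
  map_mul' _ _ := rfl
  map_zero' := rfl
  map_add' _ _ := rfl
  map_smul' _ _ := rfl
  map_star' _ := rfl

theorem toUnital_mem (hsrc : Λ.NoSources) (x : GraphAlgebra.{u, v, w} Λ) :
    toUnital hsrc x ∈ semigroupoidSubalgebra.{max u v, w} (Mor C) := by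
  refine mem_of_generators_mem (s := Set.range (kpFamily.{u, v, w} Λ))
    (K := (semigroupoidSubalgebra.{max u v, w} (Mor C)).comap (toUnital hsrc))
    ((isClosed_closedAdjoin _).preimage (map_continuous (toUnital hsrc))) ?_ x
  rintro _ ⟨f, rfl⟩
  exact (SemigroupoidAlgebra.gen.{max u v, w} (Mor C) f).2

/-- The homomorphism from the graph algebra to the semigroupoid algebra. -/
noncomputable def toSemigroupoidAlgebra (hsrc : Λ.NoSources) :
    GraphAlgebra.{u, v, w} Λ →⋆ₙₐ[ℂ] SemigroupoidAlgebra.{max u v, w} (Mor C) :=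
  NonUnitalStarAlgHom.codRestrict (toUnital hsrc) (semigroupoidSubalgebra.{max u v, w} (Mor C))
    (toUnital_mem hsrc)

theorem toSemigroupoidAlgebra_gen (hsrc : Λ.NoSources) (f : Mor C) :
    toSemigroupoidAlgebra hsrc (gen.{u, v, w} Λ f) =
      SemigroupoidAlgebra.gen.{max u v, w} (Mor C) f := rfl

/-- Every homomorphism that sends the generators to a tight representation factors through the
universal unital C*-algebra. -/
theorem exists_comp_toUnital_eq (hsrc : Λ.NoSources) {B : Type (max u v w)} [CStarAlgebra B]
    (φ : GraphAlgebra.{u, v, w} Λ →⋆ₙₐ[ℂ] B)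
    (hφ : IsTightRepresentation fun f => φ (gen.{u, v, w} Λ f)) :
    ∃ ψ : UnitalSemigroupoidAlgebra.{max u v, w} (Mor C) →⋆ₐ[ℂ] B,
      ∀ x, ψ (toUnital hsrc x) = φ x := by
  obtain ⟨ψ, hψ, -⟩ := existsUnique_lift_tight.{max u v, w} (Mor C) hφ
  refine ⟨ψ, fun x => ?_⟩
  have h := (existsUnique_lift_KP.{u, v, w} Λ (Λ.gen_isKP.map φ)).unique
    (y₁ := ψ.toNonUnitalStarAlgHom.comp (toUnital hsrc)) (y₂ := φ) hψ fun _ => rfl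
  exact DFunLike.congr_fun h x

/-- With infinitely many objects, tightness needs no nondegeneracy, so the unitization of the
carrier serves as the unital target. -/
theorem evalKP_eq_zero_of_infinite (hfin : Λ.RowFinite) (hsrc : Λ.NoSources) (hC : Infinite C)
    (i : KPFamily.{u, v, w} Λ) {x : GraphAlgebra.{u, v, w} Λ} (hx : toUnital hsrc x = 0) :
    Λ.evalKP i x = 0 := by
  let φ : GraphAlgebra.{u, v, w} Λ →⋆ₙₐ[ℂ] Unitization ℂ i.carrier :=
    (Unitization.inrNonUnitalStarAlgHom ℂ i.carrier).comp (Λ.evalKP i)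
  obtain ⟨ψ, hψ⟩ := exists_comp_toUnital_eq hsrc φ
    ((Λ.gen_isKP.map φ).isTightRepresentation hfin fun h => absurd h hC.not_finite)
  have h : ((Λ.evalKP i x : i.carrier) : Unitization ℂ i.carrier) = 0 := by
    rw [← map_zero ψ, ← hx]
    exact (hψ x).symm
  exact Unitization.inr_injective (h.trans (Unitization.inr_zero ℂ).symm)

/-- The unitization would fail here: the identities cover everything, but their join `p` is not its
unit. In the corner of `p`, where the family lives, `p` is the unit and the family is tight. -/
theorem evalKP_eq_zero_of_finite (hfin : Λ.RowFinite) (hsrc : Λ.NoSources) (hC : Finite C)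
    (i : KPFamily.{u, v, w} Λ) {x : GraphAlgebra.{u, v, w} Λ} (hx : toUnital hsrc x = 0) :
    Λ.evalKP i x = 0 := by
  have := Fintype.ofFinite C
  classical
  have hT := i.isKP
  let p : i.carrier := ∑ x : C, i.toFun (Mor.id x)
  have hpl : ∀ f, p * i.toFun f = i.toFun f := fun f => by
    rw [Finset.sum_mul, Finset.sum_eq_single f.rng, hT.id_mul]
    · exact fun x _ hx => hT.id_mul_of_ne hx
    · simp
  have hpr : ∀ f, i.toFun f * p = i.toFun f := fun f => by
    rw [Finset.mul_sum, Finset.sum_eq_single f.src, hT.mul_id]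
    · exact fun x _ hx => hT.mul_eq_zero (g := Mor.id x) hx.symm
    · simp
  have hp : IsSelfAdjoint p := by
    rw [IsSelfAdjoint, star_sum]
    exact Finset.sum_congr rfl fun x _ => (hT.projection x).isSelfAdjoint.star_eq
  have hpp : p * p = p := by
    rw [Finset.mul_sum]
    exact Finset.sum_congr rfl fun x _ => hpl _
  let K := cornerSubalgebra hp
  let _ : NonUnitalCStarAlgebra K := NonUnitalStarSubalgebra.nonUnitalCStarAlgebra K
    (h_closed := isClosed_cornerSubalgebra hp)
  let e : K := ⟨p, hpp, hpp⟩
  let T : Mor C → K := fun f => ⟨i.toFun f, hpl f, hpr f⟩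
  have hT' : Λ.IsKPFamily T :=
    IsKPFamily.of_injective (φ := NonUnitalStarSubalgebraClass.subtype K)
      Subtype.val_injective hT
  obtain ⟨φ, hφ, -⟩ := existsUnique_lift_KP.{u, v, w} Λ hT'
  have hφT : (fun f => φ (gen.{u, v, w} Λ f)) = T := funext hφ
  -- Uniqueness of lifts identifies `φ`, followed by the inclusion of the corner, with the
  -- evaluation.
  have hinc : ∀ x, (φ x : i.carrier) = Λ.evalKP i x := fun x => by
    have h := (existsUnique_lift_KP.{u, v, w} Λ hT).unique
      (y₁ := (NonUnitalStarSubalgebraClass.subtype K).comp φ) (y₂ := Λ.evalKP i)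
      (fun f => congrArg Subtype.val (hφ f)) fun _ => rfl
    exact DFunLike.congr_fun h x
  let _ : CStarAlgebra K := NonUnitalCStarAlgebra.toCStarAlgebraOfUnit e
    (fun a => Subtype.ext a.2.1) (fun a => Subtype.ext a.2.2)
  have htight : IsTightRepresentation T := by
    refine IsKPFamily.isTightRepresentation (Λ := Λ) hT' hfin fun _ a ha => ?_
    have he : e = ∑ x : C, T (Mor.id x) := Subtype.ext (by simp [e, T, p])
    have h1 : a * e = a := Subtype.ext a.2.2
    rw [← h1, he, Finset.mul_sum]
    exact Finset.sum_eq_zero fun x _ => ha x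
  obtain ⟨ψ, hψ⟩ := exists_comp_toUnital_eq hsrc φ (hφT ▸ htight)
  rw [← hinc, ← hψ, hx, map_zero]
  rfl

theorem toSemigroupoidAlgebra_injective (hfin : Λ.RowFinite) (hsrc : Λ.NoSources) :
    Function.Injective (toSemigroupoidAlgebra.{u, v, w} hsrc) := by
  rw [injective_iff_map_eq_zero]
  intro x hx
  have hx' : toUnital hsrc x = 0 := congrArg Subtype.val hx
  refine evalKP_ext Λ fun i => ?_
  rw [map_zero]
  rcases finite_or_infinite C with hC | hC
  · exact evalKP_eq_zero_of_finite hfin hsrc hC i hx'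
  · exact evalKP_eq_zero_of_infinite hfin hsrc hC i hx'

theorem toSemigroupoidAlgebra_surjective (hfin : Λ.RowFinite) (hsrc : Λ.NoSources) :
    Function.Surjective (toSemigroupoidAlgebra.{u, v, w} hsrc) := by
  -- An injective *-homomorphism of C*-algebras is isometric, so its range is closed; it contains
  -- the generators.
  have hcl := (NonUnitalStarAlgHom.isometry (toSemigroupoidAlgebra.{u, v, w} hsrc)
    (toSemigroupoidAlgebra_injective hfin hsrc)).isClosedEmbedding.isClosed_range
  intro y
  refine mem_of_generators_mem (s := Set.range (universalTight.{max u v, w} (Mor C)))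
    (K := NonUnitalStarAlgHom.range (toSemigroupoidAlgebra.{u, v, w} hsrc)) hcl ?_ y
  rintro _ ⟨f, rfl⟩
  exact ⟨gen Λ f, rfl⟩

end KGraph

theorem theorem8p7 {C : Type u} [Category.{v} C] {k : ℕ} (Λ : KGraph k C)
    (hfin : Λ.RowFinite) (hsrc : Λ.NoSources) :
    (∃ Φ : KGraph.GraphAlgebra.{u, v, w} Λ ≃⋆ₐ[ℂ] SemigroupoidAlgebra.{max u v, w} (Mor C),
      ∀ f : Mor C, Φ (KGraph.gen.{u, v, w} Λ f) = SemigroupoidAlgebra.gen.{max u v, w} (Mor C) f) ∧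
    ∀ (l : ℕ) (Λ' : KGraph l C), Λ'.RowFinite → Λ'.NoSources →
      ∃ Ψ : KGraph.GraphAlgebra.{u, v, w} Λ ≃⋆ₐ[ℂ] KGraph.GraphAlgebra.{u, v, w} Λ',
        ∀ f : Mor C, Ψ (KGraph.gen.{u, v, w} Λ f) = KGraph.gen.{u, v, w} Λ' f := by
  have key : ∀ (l : ℕ) (Λ : KGraph l C), Λ.RowFinite → Λ.NoSources →
      ∃ Φ : KGraph.GraphAlgebra.{u, v, w} Λ ≃⋆ₐ[ℂ] SemigroupoidAlgebra.{max u v, w} (Mor C),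
        ∀ f : Mor C,
          Φ (KGraph.gen.{u, v, w} Λ f) = SemigroupoidAlgebra.gen.{max u v, w} (Mor C) f :=
    fun l Λ hfin hsrc => ⟨StarAlgEquiv.ofBijective (KGraph.toSemigroupoidAlgebra hsrc)
      ⟨KGraph.toSemigroupoidAlgebra_injective hfin hsrc,
        KGraph.toSemigroupoidAlgebra_surjective hfin hsrc⟩,
      KGraph.toSemigroupoidAlgebra_gen hsrc⟩
  obtain ⟨Φ, hΦ⟩ := key k Λ hfin hsrc
  refine ⟨⟨Φ, hΦ⟩, fun l Λ' hfin' hsrc' => ?_⟩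
  obtain ⟨Φ', hΦ'⟩ := key l Λ' hfin' hsrc'
  -- Both graph algebras are identified with the same semigroupoid algebra, which involves no
  -- degree.
  refine ⟨Φ.trans Φ'.symm, fun f => ?_⟩
  rw [StarAlgEquiv.trans_apply, hΦ, ← hΦ', StarAlgEquiv.symm_apply_apply]
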